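/- Let $a<b$ and $c<d$ be real numbers. Let $\{\varphi_i\}_{i=1}^n$ be a finite orthonormal system in the complex space $L_2[a,b]$ and let $h_1,\dots,h_n$ be essentially bounded real functions on $[c,d]$; let $\{\psi_j\}_{j=1}^m$ be a finite orthonormal system in $L_2[c,d]$ and let $p_1,\dots,p_m$ be essentially bounded real functions on $[a,b]$. Consider on the complex Hilbert space $L_2([a,b]\times[c,d])$ the bounded operators (which are self-adjoint) $$(T_1f)(x,y)=\int_a^b\Big(\sum_{i=1}^n\varphi_i(x)\overline{\varphi_i(s)}h_i(y)\Big)f(s,y)\,ds,\qquad (T_2f)(x,y)=\int_c^d\Big(\sum_{j=1}^m p_j(x)\psi_j(y)\overline{\psi_j(t)}\Big)f(x,t)\,dt .$$ For a measurable real function $u$ on an interval $I$, let $\operatorname{Essran}(u)$ be the set of all $\lambda\in\mathbb R$ such that $\{\xi\in I:\lambda-\varepsilon<u(\xi)<\lambda+\varepsilon\}$ has positive Lebesgue measure for every $\varepsilon>0$. For a bounded self-adjoint operator $T$, let $\sigma_{ess}(T)$ be the set of points of the spectrum $\sigma(T)$ that are not isolated points of $\sigma(T)$ which are eigenvalues of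 finite multiplicity. Then $$\sigma_{ess}(T_1+T_2)=\{0\}\cup\bigcup_{i=1}^n\operatorname{Essran}(h_i)\cup\bigcup_{j=1}^m\operatorname{Essran}(p_j).$$ -/

import Mathlib

open MeasureTheory
open scoped ENNReal ComplexConjugate

noncomputable section

/-- Lebesgue measure on the interval `[a, b]`. -/
abbrev intervalMeasure (a b : ℝ) : Measure ℝ := volume.restrict (Set.Icc a b)

/-- Lebesgue measure on the rectangle `[a, b] × [c, d]`, as a product measure. -/
abbrev rectangleMeasure (a b c d : ℝ) : Measure (ℝ × ℝ) :=
  (intervalMeasure a b).prod (intervalMeasure c d)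

theorem rectangleMeasure_eq (a b c d : ℝ) :
    rectangleMeasure a b c d = volume.restrict (Set.Icc a b ×ˢ Set.Icc c d) :=
  Measure.prod_restrict _ _

/-- The set of essential values of a real function `φ` with respect to `μ`. -/
def essRan {α : Type*} [MeasurableSpace α] (μ : Measure α) (φ : α → ℝ) : Set ℝ :=
  {l | ∀ ε : ℝ, 0 < ε → 0 < μ {ξ | l - ε < φ ξ ∧ φ ξ < l + ε}}

section Spectrum

variable {H : Type*} [NormedAddCommGroup H] [InnerProductSpace ℂ H]

/-- The discrete spectrum of a (self-adjoint) bounded operator: the eigenvalues of finite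
multiplicity that are isolated points of the spectrum. -/
def discreteSpectrum (T : H →L[ℂ] H) : Set ℂ :=
  {z | (∃ ε : ℝ, 0 < ε ∧ ∀ w ∈ spectrum ℂ T, dist w z < ε → w = z) ∧
    Module.End.HasEigenvalue (T : Module.End ℂ H) z ∧
    FiniteDimensional ℂ (Module.End.eigenspace (T : Module.End ℂ H) z)}

/-- The essential spectrum of a (self-adjoint) bounded operator: the complement of the discrete
spectrum in the spectrum. -/
def essentialSpectrum (T : H →L[ℂ] H) : Set ℂ :=
  spectrum ℂ T \ discreteSpectrum T

end Spectrum

/-- The partial integral in the first variable with kernel `k (x, s, y)`: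
`(x, y) ↦ ∫ k (x, s, y) f (s, y) dμ(s)`. -/
def partialInt₁ (μ : Measure ℝ) (k : ℝ → ℝ → ℝ → ℂ) (f : ℝ × ℝ → ℂ) : ℝ × ℝ → ℂ :=
  fun z => ∫ s, k z.1 s z.2 * f (s, z.2) ∂μ

/-- The partial integral in the second variable with kernel `k (x, t, y)`:
`(x, y) ↦ ∫ k (x, t, y) f (x, t) dν(t)`. -/
def partialInt₂ (ν : Measure ℝ) (k : ℝ → ℝ → ℝ → ℂ) (f : ℝ × ℝ → ℂ) : ℝ × ℝ → ℂ :=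
  fun z => ∫ t, k z.1 t z.2 * f (z.1, t) ∂ν

section Kernels

variable {μ ν : Measure ℝ}

/-- The degenerate kernel `k₁(x, s, y) = ∑ᵢ φᵢ(x) conj(φᵢ(s)) hᵢ(y)`. -/
def degenerateKernel₁ {n : ℕ} (φ : Fin n → Lp ℂ 2 μ) (h : Fin n → Lp ℝ ∞ ν) :
    ℝ → ℝ → ℝ → ℂ :=
  fun x s y => ∑ i, φ i x * conj (φ i s) * (h i y : ℂ)

/-- The degenerate kernel `k₂(x, t, y) = ∑ⱼ pⱼ(x) ψⱼ(y) conj(ψⱼ(t))`. -/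
def degenerateKernel₂ {m : ℕ} (p : Fin m → Lp ℝ ∞ μ) (ψ : Fin m → Lp ℂ 2 ν) :
    ℝ → ℝ → ℝ → ℂ :=
  fun x t y => ∑ j, (p j x : ℂ) * ψ j y * conj (ψ j t)

/-! Auxiliary facts: these partial integrals map `L²` linearly and boundedly to `L²`. -/

theorem eLpNorm_two_prod_mul [SFinite μ] [SFinite ν] {u v : ℝ → ℂ}
    (hu : AEStronglyMeasurable u μ) (hv : AEStronglyMeasurable v ν) :
    eLpNorm (fun z : ℝ × ℝ => u z.1 * v z.2) 2 (μ.prod ν) = eLpNorm u 2 μ * eLpNorm v 2 ν := by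
  simp only [eLpNorm_eq_lintegral_rpow_enorm_toReal two_ne_zero ENNReal.ofNat_ne_top,
    enorm_mul]
  rw [← ENNReal.mul_rpow_of_nonneg _ _ (by positivity)]
  congr 1
  rw [← lintegral_prod_mul (by fun_prop) (by fun_prop)]
  refine lintegral_congr fun z => ?_
  rw [ENNReal.mul_rpow_of_nonneg _ _ (by positivity)]

theorem eLpNorm_two_slice [SFinite μ] [SFinite ν] {f : ℝ × ℝ → ℂ}
    (hf : AEStronglyMeasurable f (μ.prod ν)) :
    ∫⁻ y, eLpNorm (fun s => f (s, y)) 2 μ ^ (2 : ℝ) ∂ν = eLpNorm f 2 (μ.prod ν) ^ (2 : ℝ) := by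
  simp only [eLpNorm_eq_lintegral_rpow_enorm_toReal two_ne_zero ENNReal.ofNat_ne_top,
    ENNReal.toReal_ofNat, ← ENNReal.rpow_mul]
  norm_num
  rw [lintegral_prod_symm _ (by fun_prop)]

theorem ae_memLp_slice [SFinite μ] [SFinite ν] {f : ℝ × ℝ → ℂ} (hf : MemLp f 2 (μ.prod ν)) :
    ∀ᵐ y ∂ν, MemLp (fun s => f (s, y)) 2 μ := by
  have hm : ∀ᵐ y ∂ν, AEStronglyMeasurable (fun s => f (s, y)) μ := by
    have := (hf.1.comp_measurePreserving (Measure.measurePreserving_swap (μ := ν) (ν := μ)))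
    exact this.prodMk_left
  have hmeas : AEMeasurable (fun y => ∫⁻ s, ‖f (s, y)‖ₑ ^ (2 : ℝ) ∂μ) ν := by
    have := (hf.1.comp_measurePreserving (Measure.measurePreserving_swap (μ := ν) (ν := μ)))
    exact (this.enorm.pow_const (2 : ℝ)).lintegral_prod_right'
  have hfin : ∫⁻ y, ∫⁻ s, ‖f (s, y)‖ₑ ^ (2 : ℝ) ∂μ ∂ν ≠ ∞ := by
    rw [← lintegral_prod_symm _ (hf.1.enorm.pow_const (2 : ℝ))]
    have := lintegral_rpow_enorm_lt_top_of_eLpNorm_lt_top two_ne_zero ENNReal.ofNat_ne_top hf.2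
    simpa using this.ne
  filter_upwards [hm, ae_lt_top' hmeas hfin] with y h1 h2
  refine ⟨h1, ?_⟩
  rw [eLpNorm_lt_top_iff_lintegral_rpow_enorm_lt_top two_ne_zero ENNReal.ofNat_ne_top]
  simpa using h2

/-- The coefficient of the slice `f (·, y)` along `φ`. -/
def sliceCoeff (φ : Lp ℂ 2 μ) (f : ℝ × ℝ → ℂ) : ℝ → ℂ :=
  fun y => ∫ s, conj (φ s) * f (s, y) ∂μ

theorem memLp_conj (φ : Lp ℂ 2 μ) : MemLp (fun s => conj (φ s)) 2 μ :=
  (Lp.memLp φ).star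

theorem aestronglyMeasurable_sliceCoeff [SFinite μ] [SFinite ν] (φ : Lp ℂ 2 μ)
    {f : ℝ × ℝ → ℂ} (hf : AEStronglyMeasurable f (μ.prod ν)) :
    AEStronglyMeasurable (sliceCoeff φ f) ν := by
  have h0 : AEStronglyMeasurable (fun z : ℝ × ℝ => f (z.2, z.1)) (ν.prod μ) :=
    hf.comp_measurePreserving (Measure.measurePreserving_swap (μ := ν) (ν := μ))
  have h1 : AEStronglyMeasurable (fun z : ℝ × ℝ => conj (φ z.2) * f (z.2, z.1)) (ν.prod μ) :=
    ((memLp_conj φ).1.comp_snd).mul h0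
  exact h1.integral_prod_right'

theorem enorm_sliceCoeff_le (φ : Lp ℂ 2 μ) {f : ℝ × ℝ → ℂ} {y : ℝ}
    (hf : MemLp (fun s => f (s, y)) 2 μ) :
    ‖sliceCoeff φ f y‖ₑ ≤ eLpNorm φ 2 μ * eLpNorm (fun s => f (s, y)) 2 μ := by
  have h0 : eLpNorm (fun s => conj (φ s)) 2 μ = eLpNorm φ 2 μ :=
    eLpNorm_congr_norm_ae (by simp)
  have h1 : eLpNorm ((fun s => conj (φ s)) • fun s => f (s, y)) 1 μ ≤
      eLpNorm (fun s => conj (φ s)) 2 μ * eLpNorm (fun s => f (s, y)) 2 μ :=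
    eLpNorm_smul_le_mul_eLpNorm (p := 2) (q := 2) (r := 1) hf.1 (memLp_conj φ).1
  calc ‖sliceCoeff φ f y‖ₑ ≤ ∫⁻ s, ‖conj (φ s) * f (s, y)‖ₑ ∂μ :=
        enorm_integral_le_lintegral_enorm _
    _ = eLpNorm ((fun s => conj (φ s)) • fun s => f (s, y)) 1 μ := by
        rw [eLpNorm_one_eq_lintegral_enorm]; rfl
    _ ≤ eLpNorm (fun s => conj (φ s)) 2 μ * eLpNorm (fun s => f (s, y)) 2 μ := h1
    _ = _ := by rw [h0]

theorem eLpNorm_sliceCoeff_le [SFinite μ] [SFinite ν] (φ : Lp ℂ 2 μ)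
    {f : ℝ × ℝ → ℂ} (hf : MemLp f 2 (μ.prod ν)) :
    eLpNorm (sliceCoeff φ f) 2 ν ≤ eLpNorm φ 2 μ * eLpNorm f 2 (μ.prod ν) := by
  rw [← ENNReal.rpow_le_rpow_iff (z := 2) (by norm_num),
    ENNReal.mul_rpow_of_nonneg _ _ (by norm_num), ← eLpNorm_two_slice hf.1,
    ← lintegral_const_mul' _ _ (ENNReal.rpow_ne_top_of_nonneg (by norm_num) (Lp.memLp φ).2.ne)]
  have : eLpNorm (sliceCoeff φ f) 2 ν ^ (2 : ℝ) = ∫⁻ y, ‖sliceCoeff φ f y‖ₑ ^ (2 : ℝ) ∂ν := by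
    rw [eLpNorm_eq_lintegral_rpow_enorm_toReal two_ne_zero ENNReal.ofNat_ne_top,
      ENNReal.toReal_ofNat, ← ENNReal.rpow_mul]
    norm_num
  rw [this]
  refine lintegral_mono_ae ?_
  filter_upwards [ae_memLp_slice hf] with y hy
  rw [← ENNReal.mul_rpow_of_nonneg _ _ (by norm_num)]
  exact ENNReal.rpow_le_rpow (enorm_sliceCoeff_le φ hy) (by norm_num)

theorem memLp_sliceCoeff [SFinite μ] [SFinite ν] (φ : Lp ℂ 2 μ)
    {f : ℝ × ℝ → ℂ} (hf : MemLp f 2 (μ.prod ν)) : MemLp (sliceCoeff φ f) 2 ν :=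
  ⟨aestronglyMeasurable_sliceCoeff φ hf.1, (eLpNorm_sliceCoeff_le φ hf).trans_lt
    (ENNReal.mul_lt_top (Lp.memLp φ).2 hf.2)⟩

/-- One summand of the partial integral with degenerate kernel. -/
def degenerateTerm (φ : Lp ℂ 2 μ) (h : Lp ℝ ∞ ν) (f : ℝ × ℝ → ℂ) : ℝ × ℝ → ℂ :=
  fun z => φ z.1 * ((h z.2 : ℂ) * sliceCoeff φ f z.2)

theorem memLp_ofReal_top (h : Lp ℝ ∞ ν) : MemLp (fun y => (h y : ℂ)) ∞ ν :=
  (Lp.memLp h).ofReal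

theorem eLpNorm_degenerateTerm_le [SFinite μ] [SFinite ν] (φ : Lp ℂ 2 μ) (h : Lp ℝ ∞ ν)
    {f : ℝ × ℝ → ℂ} (hf : MemLp f 2 (μ.prod ν)) :
    eLpNorm (degenerateTerm φ h f) 2 (μ.prod ν) ≤
      eLpNorm φ 2 μ * (eLpNorm (fun y => (h y : ℂ)) ∞ ν * eLpNorm φ 2 μ) *
        eLpNorm f 2 (μ.prod ν) := by
  have hs := memLp_sliceCoeff φ hf
  have he := eLpNorm_two_prod_mul (Lp.memLp φ).1 ((memLp_ofReal_top h).1.mul hs.1)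
  simp only [Pi.mul_apply] at he
  unfold degenerateTerm
  rw [he, mul_assoc, mul_assoc]
  gcongr
  exact (eLpNorm_smul_le_mul_eLpNorm (p := ∞) hs.1 (memLp_ofReal_top h).1).trans
    (by gcongr; exact eLpNorm_sliceCoeff_le φ hf)

theorem memLp_degenerateTerm [SFinite μ] [SFinite ν] (φ : Lp ℂ 2 μ) (h : Lp ℝ ∞ ν)
    {f : ℝ × ℝ → ℂ} (hf : MemLp f 2 (μ.prod ν)) :
    MemLp (degenerateTerm φ h f) 2 (μ.prod ν) := by
  refine ⟨?_, (eLpNorm_degenerateTerm_le φ h hf).trans_lt ?_⟩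
  · exact (Lp.memLp φ).1.comp_fst.mul
      (((memLp_ofReal_top h).1.mul (memLp_sliceCoeff φ hf).1).comp_snd)
  · exact ENNReal.mul_lt_top (ENNReal.mul_lt_top (Lp.memLp φ).2
      (ENNReal.mul_lt_top (memLp_ofReal_top h).2 (Lp.memLp φ).2)) hf.2

theorem ae_prod_snd [SFinite μ] [SFinite ν] {P : ℝ → Prop} (h : ∀ᵐ y ∂ν, P y) :
    ∀ᵐ z ∂(μ.prod ν), P z.2 :=
  Measure.quasiMeasurePreserving_snd.ae h

theorem ae_ae_slice [SFinite μ] [SFinite ν] {P : ℝ × ℝ → Prop} (h : ∀ᵐ z ∂(μ.prod ν), P z) :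
    ∀ᵐ y ∂ν, ∀ᵐ s ∂μ, P (s, y) := by
  have := (Measure.measurePreserving_swap (μ := ν) (ν := μ)).quasiMeasurePreserving.ae h
  exact Measure.ae_ae_of_ae_prod this

theorem partialInt₁_ae_eq_sum [SFinite μ] [SFinite ν] {n : ℕ} (φ : Fin n → Lp ℂ 2 μ)
    (h : Fin n → Lp ℝ ∞ ν) {f : ℝ × ℝ → ℂ} (hf : MemLp f 2 (μ.prod ν)) :
    partialInt₁ μ (degenerateKernel₁ φ h) f =ᵐ[μ.prod ν]
      fun z => ∑ i, degenerateTerm (φ i) (h i) f z := by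
  filter_upwards [ae_prod_snd (μ := μ) (ae_memLp_slice hf)] with z hz
  have hi : ∀ i, Integrable (fun s => conj (φ i s) * f (s, z.2)) μ := fun i =>
    memLp_one_iff_integrable.1 (hz.mul' (memLp_conj (φ i)))
  simp only [partialInt₁, degenerateKernel₁, degenerateTerm, sliceCoeff, Finset.sum_mul]
  have he : ∀ i s, φ i z.1 * conj (φ i s) * (h i z.2 : ℂ) * f (s, z.2) =
      φ i z.1 * (h i z.2 : ℂ) * (conj (φ i s) * f (s, z.2)) := fun i s => by ring
  simp only [he]
  rw [integral_finsetSum _ fun i _ => (hi i).const_mul _]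
  refine Finset.sum_congr rfl fun i _ => ?_
  rw [integral_const_mul, mul_assoc]

theorem memLp_partialInt₁ [SFinite μ] [SFinite ν] {n : ℕ} (φ : Fin n → Lp ℂ 2 μ)
    (h : Fin n → Lp ℝ ∞ ν) {f : ℝ × ℝ → ℂ} (hf : MemLp f 2 (μ.prod ν)) :
    MemLp (partialInt₁ μ (degenerateKernel₁ φ h) f) 2 (μ.prod ν) :=
  (memLp_finsetSum _ fun i _ => memLp_degenerateTerm (φ i) (h i) hf).ae_eq
    (partialInt₁_ae_eq_sum φ h hf).symm

theorem exists_eLpNorm_partialInt₁_le [SFinite μ] [SFinite ν] {n : ℕ} (φ : Fin n → Lp ℂ 2 μ)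
    (h : Fin n → Lp ℝ ∞ ν) : ∃ C : ℝ≥0∞, C ≠ ∞ ∧ ∀ f : ℝ × ℝ → ℂ, MemLp f 2 (μ.prod ν) →
      eLpNorm (partialInt₁ μ (degenerateKernel₁ φ h) f) 2 (μ.prod ν) ≤
        C * eLpNorm f 2 (μ.prod ν) := by
  refine ⟨∑ i, eLpNorm (φ i) 2 μ * (eLpNorm (fun y => (h i y : ℂ)) ∞ ν * eLpNorm (φ i) 2 μ),
    ?_, fun f hf => ?_⟩
  · exact ENNReal.sum_ne_top.2 fun i _ => (ENNReal.mul_lt_top (Lp.memLp (φ i)).2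
      (ENNReal.mul_lt_top (memLp_ofReal_top (h i)).2 (Lp.memLp (φ i)).2)).ne
  · rw [eLpNorm_congr_ae (partialInt₁_ae_eq_sum φ h hf), Finset.sum_mul]
    have := eLpNorm_sum_le (μ := μ.prod ν) (p := 2) (s := Finset.univ)
      (f := fun i => degenerateTerm (φ i) (h i) f)
      (fun i _ => (memLp_degenerateTerm (φ i) (h i) hf).1) (by norm_num)
    refine le_trans (le_of_eq ?_) (this.trans (Finset.sum_le_sum fun i _ =>
      eLpNorm_degenerateTerm_le (φ i) (h i) hf))
    congr 1
    ext z
    simp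

theorem partialInt₁_congr [SFinite μ] [SFinite ν] (k : ℝ → ℝ → ℝ → ℂ) {f g : ℝ × ℝ → ℂ}
    (hfg : f =ᵐ[μ.prod ν] g) : partialInt₁ μ k f =ᵐ[μ.prod ν] partialInt₁ μ k g := by
  filter_upwards [ae_prod_snd (μ := μ) (ae_ae_slice hfg)] with z hz
  refine integral_congr_ae ?_
  filter_upwards [hz] with s hs
  rw [hs]

theorem partialInt₁_add [SFinite μ] [SFinite ν] {n : ℕ} (φ : Fin n → Lp ℂ 2 μ)
    (h : Fin n → Lp ℝ ∞ ν) {f g : ℝ × ℝ → ℂ} (hf : MemLp f 2 (μ.prod ν))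
    (hg : MemLp g 2 (μ.prod ν)) :
    partialInt₁ μ (degenerateKernel₁ φ h) (f + g) =ᵐ[μ.prod ν]
      partialInt₁ μ (degenerateKernel₁ φ h) f + partialInt₁ μ (degenerateKernel₁ φ h) g := by
  filter_upwards [partialInt₁_ae_eq_sum φ h hf, partialInt₁_ae_eq_sum φ h hg,
    partialInt₁_ae_eq_sum φ h (hf.add hg), ae_prod_snd (μ := μ) (ae_memLp_slice hf),
    ae_prod_snd (μ := μ) (ae_memLp_slice hg)] with z h1 h2 h3 h4 h5
  rw [h3, Pi.add_apply, h1, h2, ← Finset.sum_add_distrib]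
  refine Finset.sum_congr rfl fun i _ => ?_
  have : sliceCoeff (φ i) (f + g) z.2 = sliceCoeff (φ i) f z.2 + sliceCoeff (φ i) g z.2 := by
    simp only [sliceCoeff, Pi.add_apply, mul_add]
    exact integral_add (memLp_one_iff_integrable.1 (h4.mul' (memLp_conj (φ i))))
      (memLp_one_iff_integrable.1 (h5.mul' (memLp_conj (φ i))))
  simp only [degenerateTerm, this]
  ring

theorem partialInt₁_smul (k : ℝ → ℝ → ℝ → ℂ) (a : ℂ) (f : ℝ × ℝ → ℂ) :
    partialInt₁ μ k (a • f) = a • partialInt₁ μ k f := by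
  ext z
  simp only [partialInt₁, Pi.smul_apply, smul_eq_mul, mul_left_comm _ a]
  exact integral_const_mul _ _

/-- Exchanging the two variables turns the second type of partial integral into the first. -/
theorem partialInt₂_eq_swap {m : ℕ} (p : Fin m → Lp ℝ ∞ μ) (ψ : Fin m → Lp ℂ 2 ν)
    (f : ℝ × ℝ → ℂ) :
    partialInt₂ ν (degenerateKernel₂ p ψ) f =
      partialInt₁ ν (degenerateKernel₁ ψ p) (f ∘ Prod.swap) ∘ Prod.swap := by
  ext z
  simp only [partialInt₂, partialInt₁, degenerateKernel₁, degenerateKernel₂, Function.comp,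
    Prod.swap]
  refine integral_congr_ae (Filter.Eventually.of_forall fun t => ?_)
  simp only
  congr 1
  exact Finset.sum_congr rfl fun i _ => by ring

theorem memLp_swap [SFinite μ] [SFinite ν] {f : ℝ × ℝ → ℂ} (hf : MemLp f 2 (μ.prod ν)) :
    MemLp (f ∘ Prod.swap) 2 (ν.prod μ) :=
  hf.comp_measurePreserving Measure.measurePreserving_swap

theorem memLp_partialInt₂ [SFinite μ] [SFinite ν] {m : ℕ} (p : Fin m → Lp ℝ ∞ μ)
    (ψ : Fin m → Lp ℂ 2 ν) {f : ℝ × ℝ → ℂ} (hf : MemLp f 2 (μ.prod ν)) :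
    MemLp (partialInt₂ ν (degenerateKernel₂ p ψ) f) 2 (μ.prod ν) := by
  rw [partialInt₂_eq_swap]
  exact memLp_swap (memLp_partialInt₁ ψ p (memLp_swap hf))

theorem partialInt₂_congr [SFinite μ] [SFinite ν] (k : ℝ → ℝ → ℝ → ℂ) {f g : ℝ × ℝ → ℂ}
    (hfg : f =ᵐ[μ.prod ν] g) : partialInt₂ ν k f =ᵐ[μ.prod ν] partialInt₂ ν k g := by
  have h1 : ∀ᵐ x ∂μ, ∀ᵐ t ∂ν, f (x, t) = g (x, t) := Measure.ae_ae_of_ae_prod hfg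
  filter_upwards [Measure.quasiMeasurePreserving_fst.ae h1] with z hz
  refine integral_congr_ae ?_
  filter_upwards [hz] with t ht
  rw [ht]

theorem partialInt₂_add [SFinite μ] [SFinite ν] {m : ℕ} (p : Fin m → Lp ℝ ∞ μ)
    (ψ : Fin m → Lp ℂ 2 ν) {f g : ℝ × ℝ → ℂ} (hf : MemLp f 2 (μ.prod ν))
    (hg : MemLp g 2 (μ.prod ν)) :
    partialInt₂ ν (degenerateKernel₂ p ψ) (f + g) =ᵐ[μ.prod ν]
      partialInt₂ ν (degenerateKernel₂ p ψ) f + partialInt₂ ν (degenerateKernel₂ p ψ) g := by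
  simp only [partialInt₂_eq_swap]
  exact (Measure.measurePreserving_swap (μ := μ) (ν := ν)).quasiMeasurePreserving.ae_eq_comp
    (partialInt₁_add ψ p (memLp_swap hf) (memLp_swap hg))

theorem partialInt₂_smul (k : ℝ → ℝ → ℝ → ℂ) (a : ℂ) (f : ℝ × ℝ → ℂ) :
    partialInt₂ ν k (a • f) = a • partialInt₂ ν k f := by
  ext z
  simp only [partialInt₂, Pi.smul_apply, smul_eq_mul, mul_left_comm _ a]
  exact integral_const_mul _ _

theorem exists_eLpNorm_partialInt₂_le [SFinite μ] [SFinite ν] {m : ℕ} (p : Fin m → Lp ℝ ∞ μ)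
    (ψ : Fin m → Lp ℂ 2 ν) : ∃ C : ℝ≥0∞, C ≠ ∞ ∧ ∀ f : ℝ × ℝ → ℂ, MemLp f 2 (μ.prod ν) →
      eLpNorm (partialInt₂ ν (degenerateKernel₂ p ψ) f) 2 (μ.prod ν) ≤
        C * eLpNorm f 2 (μ.prod ν) := by
  obtain ⟨C, hC, h⟩ := exists_eLpNorm_partialInt₁_le ψ p
  refine ⟨C, hC, fun f hf => ?_⟩
  have hg := memLp_swap hf
  rw [partialInt₂_eq_swap, eLpNorm_comp_measurePreserving (memLp_partialInt₁ ψ p hg).1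
    Measure.measurePreserving_swap]
  refine (h _ hg).trans (le_of_eq ?_)
  rw [eLpNorm_comp_measurePreserving hf.1 Measure.measurePreserving_swap]

/-- The partial integral operator `T₁` on `L²` with kernel `∑ᵢ φᵢ(x) conj(φᵢ(s)) hᵢ(y)`:
`(T₁ f)(x, y) = ∫ k₁(x, s, y) f(s, y) dμ(s)`. -/
def partialIntegralOp₁ [SFinite μ] [SFinite ν] {n : ℕ} (φ : Fin n → Lp ℂ 2 μ)
    (h : Fin n → Lp ℝ ∞ ν) : Lp ℂ 2 (μ.prod ν) →L[ℂ] Lp ℂ 2 (μ.prod ν) :=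
  LinearMap.mkContinuousOfExistsBound
    { toFun := fun f => (memLp_partialInt₁ φ h (Lp.memLp f)).toLp
        (partialInt₁ μ (degenerateKernel₁ φ h) f)
      map_add' := fun f g => by
        rw [← MemLp.toLp_add]
        exact MemLp.toLp_congr _ _ ((partialInt₁_congr _ (Lp.coeFn_add f g)).trans
          (partialInt₁_add φ h (Lp.memLp f) (Lp.memLp g)))
      map_smul' := fun a f => by
        rw [RingHom.id_apply, ← MemLp.toLp_const_smul]
        exact MemLp.toLp_congr _ _ ((partialInt₁_congr _ (Lp.coeFn_smul a f)).trans
          (Filter.EventuallyEq.of_eq (partialInt₁_smul _ a f))) }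
    (by
      obtain ⟨C, hC, hb⟩ := exists_eLpNorm_partialInt₁_le φ h
      refine ⟨C.toReal, fun f => ?_⟩
      simp only [LinearMap.coe_mk, AddHom.coe_mk]
      rw [Lp.norm_toLp, Lp.norm_def, ← ENNReal.toReal_mul]
      exact ENNReal.toReal_mono (ENNReal.mul_ne_top hC (Lp.memLp f).2.ne) (hb f (Lp.memLp f)))

/-- The partial integral operator `T₂` on `L²` with kernel `∑ⱼ pⱼ(x) ψⱼ(y) conj(ψⱼ(t))`:
`(T₂ f)(x, y) = ∫ k₂(x, t, y) f(x, t) dν(t)`. -/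
def partialIntegralOp₂ [SFinite μ] [SFinite ν] {m : ℕ} (p : Fin m → Lp ℝ ∞ μ)
    (ψ : Fin m → Lp ℂ 2 ν) : Lp ℂ 2 (μ.prod ν) →L[ℂ] Lp ℂ 2 (μ.prod ν) :=
  LinearMap.mkContinuousOfExistsBound
    { toFun := fun f => (memLp_partialInt₂ p ψ (Lp.memLp f)).toLp
        (partialInt₂ ν (degenerateKernel₂ p ψ) f)
      map_add' := fun f g => by
        rw [← MemLp.toLp_add]
        exact MemLp.toLp_congr _ _ ((partialInt₂_congr _ (Lp.coeFn_add f g)).trans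
          (partialInt₂_add p ψ (Lp.memLp f) (Lp.memLp g)))
      map_smul' := fun a f => by
        rw [RingHom.id_apply, ← MemLp.toLp_const_smul]
        exact MemLp.toLp_congr _ _ ((partialInt₂_congr _ (Lp.coeFn_smul a f)).trans
          (Filter.EventuallyEq.of_eq (partialInt₂_smul _ a f))) }
    (by
      obtain ⟨C, hC, hb⟩ := exists_eLpNorm_partialInt₂_le p ψ
      refine ⟨C.toReal, fun f => ?_⟩
      simp only [LinearMap.coe_mk, AddHom.coe_mk]
      rw [Lp.norm_toLp, Lp.norm_def, ← ENNReal.toReal_mul]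
      exact ENNReal.toReal_mono (ENNReal.mul_ne_top hC (Lp.memLp f).2.ne) (hb f (Lp.memLp f)))

theorem partialIntegralOp₁_ae_eq [SFinite μ] [SFinite ν] {n : ℕ} (φ : Fin n → Lp ℂ 2 μ)
    (h : Fin n → Lp ℝ ∞ ν) (f : Lp ℂ 2 (μ.prod ν)) :
    partialIntegralOp₁ φ h f =ᵐ[μ.prod ν] partialInt₁ μ (degenerateKernel₁ φ h) f :=
  MemLp.coeFn_toLp (memLp_partialInt₁ φ h (Lp.memLp f))

theorem partialIntegralOp₂_ae_eq [SFinite μ] [SFinite ν] {m : ℕ} (p : Fin m → Lp ℝ ∞ μ)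
    (ψ : Fin m → Lp ℂ 2 ν) (f : Lp ℂ 2 (μ.prod ν)) :
    partialIntegralOp₂ p ψ f =ᵐ[μ.prod ν] partialInt₂ ν (degenerateKernel₂ p ψ) f :=
  MemLp.coeFn_toLp (memLp_partialInt₂ p ψ (Lp.memLp f))

end Kernels

end

/-! ### Two criteria for the essential spectrum of a self-adjoint operator. -/

section SelfAdjoint

open Filter Topology

variable {H : Type*} [NormedAddCommGroup H] [InnerProductSpace ℂ H]

/-! Let `J_i v = φ_i ⊗ v` and `J'_j u = u ⊗ ψ_j`. By orthonormality each family consists of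
isometries with mutually orthogonal ranges, and by Fubini `T₁ = ∑ J_i M_{h_i} J_i*` and `T₂ = ∑ J'_j
M_{p_j} J'_j*`, with `M` denoting multiplication. Thus `T₁` is `M_{h_i}` on the range of `J_i` and
zero off these ranges, and likewise for `T₂`. The two families interact only through `J_i* J'_j w =
⟨φ_i, w⟩ ψ_j`, which has rank one, so `T₁T₂` is compact.

Upper bound: if `z ≠ 0` avoids all the essential ranges, then `T₁ - z` and `T₂ - z` have left
inverses, and the identity `z(T₁ + T₂ - z) = T₁T₂ - (T₁ - z)(T₂ - z)` gives a left inverse of `T₁ +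
T₂ - z` modulo compacts. For a self-adjoint operator this excludes `z` from the essential spectrum
(`not_mem_essentialSpectrum_of_isCompactOperator`).

Lower bound: by Weyl's criterion (`mem_essentialSpectrum_of_isWeaklyNullUnit`) it suffices to find
weakly null unit vectors that are approximate eigenvectors. For `r` in the essential range of `h_i`
they are `φ_i ⊗ v_k`, with `v_k` normalized indicators of shrinking sets on which `h_i` is near `r`;
`T₂` tends to zero on them by the rank-one relation. For `0` they are `u ⊗ v_k` with `u` orthogonal
to all `φ_i`. -/

theorem mem_spectrum_iff_not_isUnit_sub {T : H →L[ℂ] H} {z : ℂ} :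
    z ∈ spectrum ℂ T ↔ ¬ IsUnit (T - z • (1 : H →L[ℂ] H)) := by
  rw [spectrum.mem_iff, ← IsUnit.neg_iff, neg_sub, Algebra.algebraMap_eq_smul_one]

/-- Write `x = B S x + K x`: the first term tends to zero along the sequence and the second
converges along a subsequence by compactness. -/
theorem tendsto_subseq_of_isCompactOperator_one_sub {B S K : H →L[ℂ] H} (hK : IsCompactOperator K)
    (hB : B * S = 1 - K) {x : ℕ → H} (hx : ∀ k, ‖x k‖ = 1)
    (hSx : Tendsto (fun k => S (x k)) atTop (𝓝 0)) :
    ∃ g : H, ∃ θ : ℕ → ℕ, StrictMono θ ∧ Tendsto (x ∘ θ) atTop (𝓝 g) := by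
  obtain ⟨C, hC, hKC⟩ := hK.image_closedBall_subset_compact (f := (K : H →ₗ[ℂ] H)) 1
  obtain ⟨g, -, θ, hθ, hg⟩ := hC.tendsto_subseq (x := fun k => K (x k))
    fun k => hKC ⟨x k, by simp [hx k], rfl⟩
  refine ⟨g, θ, hθ, ?_⟩
  have h1 : Tendsto (fun k => B (S (x k))) atTop (𝓝 0) := by
    simpa [Function.comp_def] using (B.continuous.tendsto 0).comp hSx
  have h2 := (h1.comp hθ.tendsto_atTop).add hg
  rw [zero_add] at h2
  refine h2.congr fun k => ?_
  have : B (S (x (θ k))) = x (θ k) - K (x (θ k)) := by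
    simpa using congrArg (fun A : H →L[ℂ] H => A (x (θ k))) hB
  simp [this]

/-- A bounded operator which is invertible on the left modulo compact operators is bounded below on
the orthogonal complement of its kernel. -/
theorem exists_le_norm_of_isCompactOperator_one_sub {B S K : H →L[ℂ] H} (hK : IsCompactOperator K)
    (hB : B * S = 1 - K) : ∃ c : ℝ, 0 < c ∧ ∀ x ∈ S.kerᗮ, c * ‖x‖ ≤ ‖S x‖ := by
  by_contra! hcon
  choose x hx hxn using fun k : ℕ => hcon (1 / ((k : ℝ) + 1)) (by positivity)
  have hx0 : ∀ k, ‖x k‖ ≠ 0 := fun k h0 => by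
    have := hxn k
    rw [h0, mul_zero] at this
    exact absurd this (norm_nonneg _).not_gt
  set y : ℕ → H := fun k => ((‖x k‖⁻¹ : ℝ) : ℂ) • x k
  have hy : ∀ k, ‖y k‖ = 1 := fun k => by simp [y, norm_smul, hx0 k]
  have hSy : Tendsto (fun k => S (y k)) atTop (𝓝 0) := by
    refine squeeze_zero_norm (fun k => ?_) tendsto_one_div_add_atTop_nhds_zero_nat
    have : ‖S (y k)‖ = ‖x k‖⁻¹ * ‖S (x k)‖ := by simp [y, norm_smul]
    rw [this, ← div_eq_inv_mul, div_le_iff₀ ((norm_nonneg _).lt_of_ne' (hx0 k))]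
    exact (hxn k).le
  -- The limit `g` is a unit vector lying both in the kernel of `S` and in its orthogonal
  -- complement, which is impossible.
  obtain ⟨g, θ, hθ, hg⟩ := tendsto_subseq_of_isCompactOperator_one_sub hK hB hy hSy
  have hgn : ‖g‖ = 1 := tendsto_nhds_unique hg.norm (by simp [hy])
  have hgS : S g = 0 := tendsto_nhds_unique ((S.continuous.tendsto g).comp hg)
    (hSy.comp hθ.tendsto_atTop)
  have hgo : g ∈ S.kerᗮ := (Submodule.isClosed_orthogonal _).mem_of_tendsto hg
    (Eventually.of_forall fun k => Submodule.smul_mem _ _ (hx (θ k)))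
  have : g = 0 := by
    have := (Submodule.mem_orthogonal _ _).1 hgo g hgS
    simpa using this
  simp [this] at hgn

variable [CompleteSpace H]

/-- The lower bound gives injectivity and closed range; the orthogonal complement of the range is
the kernel of the adjoint, which is `S` itself, so the range is also dense. -/
theorem IsSelfAdjoint.isUnit_of_le_norm {S : H →L[ℂ] H} (hS : IsSelfAdjoint S) {c : ℝ}
    (hc : 0 < c) (h : ∀ x, c * ‖x‖ ≤ ‖S x‖) : IsUnit S := by
  rw [ContinuousLinearMap.isUnit_iff_bijective,
    ContinuousLinearMap.bijective_iff_dense_range_and_antilipschitz]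
  have hanti : AntilipschitzWith (Real.toNNReal c⁻¹) S := by
    refine S.antilipschitz_of_bound fun x => ?_
    rw [Real.coe_toNNReal _ (by positivity), ← div_eq_inv_mul, le_div_iff₀ hc, mul_comm]
    exact h x
  refine ⟨?_, _, hanti⟩
  rw [Submodule.topologicalClosure_eq_top_iff, S.orthogonal_range, hS.adjoint_eq,
    LinearMap.ker_eq_bot]
  exact hanti.injective

theorem IsSelfAdjoint.sub_real_smul_one {T : H →L[ℂ] H} (hT : IsSelfAdjoint T) (r : ℝ) :
    IsSelfAdjoint (T - (r : ℂ) • (1 : H →L[ℂ] H)) :=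
  hT.sub (IsSelfAdjoint.smul (by simp [isSelfAdjoint_iff]) (.one _))

/-- `K` acts as the identity on the kernel of `S`, so the identity there is compact and Riesz's
theorem applies. -/
theorem finiteDimensional_ker_of_isCompactOperator_one_sub {B S K : H →L[ℂ] H}
    (hK : IsCompactOperator K) (hB : B * S = 1 - K) : FiniteDimensional ℂ S.ker := by
  have hid : ∀ x ∈ S.ker, K x = x := fun x hx => by
    have : B (S x) = x - K x := by simpa using congrArg (fun A : H →L[ℂ] H => A x) hB
    rw [show S x = 0 from hx, map_zero, eq_comm, sub_eq_zero] at this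
    exact this.symm
  have hmem : ∀ x ∈ S.ker, (K : H →ₗ[ℂ] H) x ∈ S.ker := fun x hx => by simpa [hid x hx] using hx
  have h := hK.restrict' (f := (K : H →ₗ[ℂ] H)) (V := S.ker) hmem
  refine FiniteDimensional.of_isCompactOperator_id (𝕜 := ℂ) ?_
  exact (show ⇑((K : H →ₗ[ℂ] H).restrict hmem) = id from
    funext fun x => Subtype.ext (hid x x.2)) ▸ h

/-- Let `S = T - z`. Its kernel is finite-dimensional and reduces `T`, and `S` is bounded below by
some `c` on the complement. For `0 < |w - z| < c` the operator `T - w` is the scalar `z - w` on the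
kernel and is bounded below by `c - |w - z|` on the complement, hence invertible. So a spectral
point `z` is isolated, and its kernel is nonzero, since otherwise `S` would be invertible. -/
theorem not_mem_essentialSpectrum_of_isCompactOperator {T : H →L[ℂ] H} (hT : IsSelfAdjoint T)
    {z : ℂ} {B K : H →L[ℂ] H} (hK : IsCompactOperator K)
    (hB : B * (T - z • (1 : H →L[ℂ] H)) = 1 - K) : z ∉ essentialSpectrum T := by
  rintro ⟨hz, hd⟩
  apply hd
  have hreal : ∀ w ∈ spectrum ℂ T, w = (w.re : ℂ) := fun w hw => hT.mem_spectrum_eq_re hw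
  set S := T - z • (1 : H →L[ℂ] H) with hSdef
  have hS : IsSelfAdjoint S := by
    rw [hSdef, hreal z hz]; exact hT.sub_real_smul_one _
  have hSapp : ∀ x, S x = T x - z • x := fun x => by simp [S]
  obtain ⟨c, hc, hcS⟩ := exists_le_norm_of_isCompactOperator_one_sub hK hB
  have hfin := finiteDimensional_ker_of_isCompactOperator_one_sub hK hB
  have hker : Module.End.eigenspace (T : Module.End ℂ H) z = S.ker := by
    ext x
    simp [hSapp, sub_eq_zero]
  refine ⟨⟨c, hc, fun w hw hwz => ?_⟩, ?_, hker ▸ hfin⟩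
  · by_contra hne
    refine mem_spectrum_iff_not_isUnit_sub.1 hw ?_
    have hsa : IsSelfAdjoint (T - w • (1 : H →L[ℂ] H)) := by
      rw [hreal w hw]; exact hT.sub_real_smul_one _
    rw [dist_eq_norm] at hwz
    have hpos : 0 < ‖w - z‖ := norm_pos_iff.2 (sub_ne_zero.2 hne)
    refine hsa.isUnit_of_le_norm (c := min ‖w - z‖ (c - ‖w - z‖))
      (lt_min hpos (sub_pos.2 hwz)) fun x => ?_
    set δ := min ‖w - z‖ (c - ‖w - z‖)
    have hδ : 0 < δ := lt_min hpos (sub_pos.2 hwz)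
    obtain ⟨u, hu, v, hv, rfl⟩ := S.ker.exists_add_mem_mem_orthogonal x
    have hSv : S v ∈ S.kerᗮ := by
      rw [Submodule.mem_orthogonal]
      intro q hq
      rw [← ContinuousLinearMap.adjoint_inner_left, hS.adjoint_eq, show S q = 0 from hq,
        inner_zero_left]
    have hSu : S u = 0 := hu
    set v' := S v - (w - z) • v with hv'
    have hv'm : v' ∈ S.kerᗮ := sub_mem hSv (Submodule.smul_mem _ _ hv)
    have heq : (T - w • (1 : H →L[ℂ] H)) (u + v) = (z - w) • u + v' := by
      have h1 : T u = z • u := by simpa [hSapp, sub_eq_zero] using hSu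
      have h2 : T v = S v + z • v := by simp [hSapp]
      simp only [sub_apply, map_add, h1, h2, hv', smul_apply, one_apply_eq_self]
      module
    have hn1 : ‖u + v‖ * ‖u + v‖ = ‖u‖ * ‖u‖ + ‖v‖ * ‖v‖ :=
      norm_add_sq_eq_norm_sq_add_norm_sq_of_inner_eq_zero _ _ (hv u hu)
    have hn2 := norm_add_sq_eq_norm_sq_add_norm_sq_of_inner_eq_zero ((z - w) • u) v'
      (hv'm _ (Submodule.smul_mem _ _ hu))
    have hb1 : δ * ‖u‖ ≤ ‖(z - w) • u‖ := by
      rw [norm_smul, norm_sub_rev]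
      gcongr
      exact min_le_left _ _
    have hb2 : δ * ‖v‖ ≤ ‖v'‖ := by
      have h1 := norm_sub_norm_le (S v) ((w - z) • v)
      have h2 := hcS v hv
      rw [norm_smul] at h1
      have h3 : δ * ‖v‖ ≤ (c - ‖w - z‖) * ‖v‖ := by gcongr; exact min_le_right _ _
      linarith
    rw [heq]
    -- The images of the two orthogonal components stay orthogonal, so Pythagoras combines the two
    -- lower bounds after squaring.
    refine abs_le_of_sq_le_sq' ?_ (norm_nonneg _) |>.2
    have h1 := mul_self_le_mul_self (by positivity) hb1
    have h2 := mul_self_le_mul_self (by positivity) hb2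
    calc (δ * ‖u + v‖) ^ 2 = δ * ‖u‖ * (δ * ‖u‖) + δ * ‖v‖ * (δ * ‖v‖) := by
          rw [mul_pow, sq ‖u + v‖, hn1]; ring
      _ ≤ ‖(z - w) • u + v'‖ ^ 2 := by rw [sq ‖_ + v'‖, hn2]; exact add_le_add h1 h2
  · rw [Module.End.hasEigenvalue_iff, hker]
    intro hbot
    rw [hbot] at hcS
    exact mem_spectrum_iff_not_isUnit_sub.1 hz
      (hS.isUnit_of_le_norm hc fun x => hcS x (by simp))

/-- This admits functions with a jump or a pole at an isolated spectral point into the continuous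
functional calculus. -/
theorem continuousOn_of_isolated {s : Set ℂ} {z : ℂ} {ε : ℝ} (hε : 0 < ε)
    (hs : ∀ w ∈ s, dist w z < ε → w = z) {f : ℂ → ℂ} (hf : ContinuousOn f {z}ᶜ) :
    ContinuousOn f s := by
  intro w _
  by_cases hwz : w = z
  · subst hwz
    refine tendsto_const_nhds.congr' ?_
    filter_upwards [self_mem_nhdsWithin, mem_nhdsWithin_of_mem_nhds (Metric.ball_mem_nhds w hε)]
      with v hv hvb
    rw [hs v hv hvb]
  · exact (hf.continuousAt (isOpen_compl_singleton.mem_nhds hwz)).continuousWithinAt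

/-- A weakly null sequence of unit vectors. -/
structure IsWeaklyNullUnit (x : ℕ → H) : Prop where
  norm_eq_one : ∀ k, ‖x k‖ = 1
  tendsto_inner : ∀ y, Tendsto (fun k => inner ℂ y (x k)) atTop (𝓝 0)

/-- In an orthonormal basis `b` of `N`, the coefficients of `Q x_k` are `⟨Q* b_i, x_k⟩`, finitely
many and each tending to zero. -/
theorem tendsto_zero_of_finiteDimensional {x : ℕ → H} (hx : IsWeaklyNullUnit x) {Q : H →L[ℂ] H}
    {N : Submodule ℂ H} [FiniteDimensional ℂ N] (hQ : ∀ y, Q y ∈ N) :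
    Tendsto (fun k => Q (x k)) atTop (𝓝 0) := by
  set b := stdOrthonormalBasis ℂ N
  have hrep : ∀ k, Q (x k) = ∑ i, inner ℂ (Q.adjoint (b i : H)) (x k) • (b i : H) := fun k => by
    have := congrArg (Subtype.val) (b.sum_repr' ⟨Q (x k), hQ _⟩)
    simp only [Submodule.coe_sum, Submodule.coe_smul, Submodule.coe_inner] at this
    rw [← this]
    simp [ContinuousLinearMap.adjoint_inner_left]
  simp only [hrep]
  rw [show (0 : H) = ∑ _i : Fin (Module.finrank ℂ N), 0 by simp]
  refine tendsto_finsetSum _ fun i _ => ?_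
  simpa using (hx.tendsto_inner _).smul_const (b i : H)

/-- The sufficient half of Weyl's criterion. If `T - z` were invertible, or `z` isolated with
finite-dimensional eigenspace, the sequence would tend to zero in norm, against its normalization.
-/
theorem mem_essentialSpectrum_of_isWeaklyNullUnit {T : H →L[ℂ] H} (hT : IsSelfAdjoint T) {z : ℂ}
    {x : ℕ → H} (hx : IsWeaklyNullUnit x)
    (hTx : Tendsto (fun k => T (x k) - z • x k) atTop (𝓝 0)) : z ∈ essentialSpectrum T := by
  set S := T - z • (1 : H →L[ℂ] H) with hSdef
  have hSx : Tendsto (fun k => S (x k)) atTop (𝓝 0) := by simpa [S] using hTx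
  have hcon : ¬ Tendsto x atTop (𝓝 0) := fun h => by
    have := tendsto_nhds_unique h.norm
      (by simp [hx.norm_eq_one] : Tendsto (fun k => ‖x k‖) atTop (𝓝 1))
    simp at this
  refine ⟨fun hu => hcon ?_, ?_⟩
  · obtain ⟨u, hu⟩ := not_not.1 fun h => mem_spectrum_iff_not_isUnit_sub.2 h hu
    have h1 := ((u⁻¹ : (H →L[ℂ] H)ˣ).val.continuous.tendsto 0).comp hSx
    rw [map_zero] at h1
    refine h1.congr fun k => ?_
    have := congrArg (fun A : H →L[ℂ] H => A (x k)) u.inv_mul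
    rwa [hu] at this
  · rintro ⟨⟨ε, hε, hiso⟩, -, hfin⟩
    apply hcon
    have := hT.isStarNormal
    -- `q(T)` is the spectral projection at `z` and `g(T)` a reduced resolvent: `g(w)(w - z) = 1 -
    -- q(w)`, with `g` set to zero at `z`. Hence `x_k = g(T) S x_k + q(T) x_k`.
    set q : ℂ → ℂ := fun w => if w = z then 1 else 0
    set g : ℂ → ℂ := fun w => if w = z then 0 else (w - z)⁻¹
    have hq : ContinuousOn q (spectrum ℂ T) :=
      continuousOn_of_isolated hε hiso (continuousOn_const.congr fun w hw => if_neg hw)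
    have hg : ContinuousOn g (spectrum ℂ T) :=
      continuousOn_of_isolated hε hiso (ContinuousOn.congr (f := fun w => (w - z)⁻¹)
        (ContinuousOn.inv₀ (by fun_prop) fun w hw => sub_ne_zero.2 hw) fun w hw => if_neg hw)
    have hS : S = cfc (fun w => w - z) T := by
      rw [cfc_sub _ _ T, cfc_id' ℂ T, cfc_const z T, Algebra.algebraMap_eq_smul_one]
    have hgS : cfc g T * S = 1 - cfc q T := by
      rw [hS, ← cfc_mul g _ T hg, ← cfc_one ℂ T, ← cfc_sub _ _ T]
      congr 1; ext w
      by_cases hw : w = z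
      · simp [g, q, hw]
      · simp [g, q, hw, sub_ne_zero.2 hw]
    have hSq : S * cfc q T = 0 := by
      rw [hS, ← cfc_mul _ q T (by fun_prop) hq, ← cfc_zero ℂ T]
      congr 1; ext w
      by_cases hw : w = z <;> simp [q, hw]
    have h1 : Tendsto (fun k => cfc q T (x k)) atTop (𝓝 0) := by
      refine tendsto_zero_of_finiteDimensional hx
        (N := Module.End.eigenspace (T : Module.End ℂ H) z) fun y => ?_
      have := congrArg (fun A : H →L[ℂ] H => A y) hSq
      simpa [Module.End.mem_eigenspace_iff, S, sub_eq_zero] using this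
    have h2 : Tendsto (fun k => cfc g T (S (x k))) atTop (𝓝 0) := by
      simpa [Function.comp_def] using ((cfc g T).continuous.tendsto 0).comp hSx
    have h3 := h2.add h1
    rw [zero_add] at h3
    refine h3.congr fun k => ?_
    have : cfc g T (S (x k)) = x k - cfc q T (x k) := by
      simpa using congrArg (fun A : H →L[ℂ] H => A (x k)) hgS
    simp [this]

end SelfAdjoint

/-! ### Sums of operators carried by orthogonal isometric copies. -/

section Compressions

open Filter Topology

variable {H E F : Type*} [NormedAddCommGroup H] [InnerProductSpace ℂ H] [CompleteSpace H]
  [NormedAddCommGroup E] [InnerProductSpace ℂ E] [CompleteSpace E]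
  [NormedAddCommGroup F] [InnerProductSpace ℂ F] [CompleteSpace F]
  {ι κ : Type*} [Fintype ι] [Fintype κ]

/-- The operator `∑ᵢ Jᵢ Mᵢ Jᵢ*`. -/
noncomputable def sumConj (J : ι → E →L[ℂ] H) (M : ι → E →L[ℂ] E) : H →L[ℂ] H :=
  ∑ i, J i ∘L M i ∘L (J i).adjoint

theorem sumConj_apply (J : ι → E →L[ℂ] H) (M : ι → E →L[ℂ] E) (x : H) :
    sumConj J M x = ∑ i, J i (M i ((J i).adjoint x)) := by
  simp [sumConj, sum_apply]

theorem isSelfAdjoint_sumConj (J : ι → E →L[ℂ] H) {M : ι → E →L[ℂ] E}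
    (hM : ∀ i, IsSelfAdjoint (M i)) : IsSelfAdjoint (sumConj J M) :=
  isSelfAdjoint_sum _ fun i _ => (hM i).conj_adjoint (J i)

/-- The maps `Jᵢ` are isometries with mutually orthogonal ranges. -/
def IsOrthoIsometric (J : ι → E →L[ℂ] H) : Prop :=
  ∀ i, (∀ v, (J i).adjoint (J i v) = v) ∧ ∀ k, i ≠ k → ∀ v, (J i).adjoint (J k v) = 0

theorem IsOrthoIsometric.adjoint_sumConj {J : ι → E →L[ℂ] H} (hJ : IsOrthoIsometric J)
    (M : ι → E →L[ℂ] E) (i : ι) (x : H) :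
    (J i).adjoint (sumConj J M x) = M i ((J i).adjoint x) := by
  rw [sumConj_apply, map_sum, Finset.sum_eq_single i, (hJ i).1]
  · exact fun k _ hk => (hJ i).2 k hk.symm _
  · simp

theorem IsOrthoIsometric.sumConj_comp {J : ι → E →L[ℂ] H} (hJ : IsOrthoIsometric J)
    (M : ι → E →L[ℂ] E) (i : ι) (v : E) : sumConj J M (J i v) = J i (M i v) := by
  rw [sumConj_apply, Finset.sum_eq_single i, (hJ i).1]
  · exact fun k _ hk => by rw [(hJ k).2 i hk, map_zero, map_zero]
  · simp

/-- The operator is `M_i - z` on the range of `J_i` and `-z` off all the ranges. Inverting blockwise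
gives `∑ J_i (M_i - z)⁻¹ J_i* - z⁻¹ (1 - ∑ J_i J_i*)`, where the last bracket projects onto the
complement of the ranges. -/
theorem IsOrthoIsometric.exists_mul_sumConj_sub_eq_one {J : ι → E →L[ℂ] H}
    (hJ : IsOrthoIsometric J) {M : ι → E →L[ℂ] E} {z : ℂ} (hz : z ≠ 0)
    (hM : ∀ i, IsUnit (M i - z • (1 : E →L[ℂ] E))) :
    ∃ R : H →L[ℂ] H, R * (sumConj J M - z • (1 : H →L[ℂ] H)) = 1 := by
  choose u hu using hM
  refine ⟨sumConj J (fun i => (u i)⁻¹.val) - z⁻¹ • (1 - sumConj J fun _ => 1), ?_⟩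
  ext x
  have h1 : ∀ i, (J i).adjoint ((sumConj J M - z • (1 : H →L[ℂ] H)) x) =
      (u i).val ((J i).adjoint x) := fun i => by
    simp [hJ.adjoint_sumConj, hu]
  have h2 : ∀ i v, (u i)⁻¹.val ((u i).val v) = v := fun i v =>
    congrArg (fun A : E →L[ℂ] E => A v) (u i).inv_mul
  have h3 : ∀ i v, (u i).val v = M i v - z • v := fun i v => by rw [hu]; simp
  set y := (sumConj J M - z • (1 : H →L[ℂ] H)) x with hy
  have h4 : y = sumConj J M x - z • x := by simp [hy]
  have h5 : sumConj J (fun i => (u i)⁻¹.val) y = ∑ i, J i ((J i).adjoint x) := by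
    simp only [sumConj_apply, h1, h2]
  have h6 : sumConj J (fun _ => 1) y = sumConj J M x - z • ∑ i, J i ((J i).adjoint x) := by
    simp only [sumConj_apply, h1, h3, one_apply_eq_self, map_sub, map_smul,
      Finset.sum_sub_distrib, Finset.smul_sum]
  change sumConj J (fun i => (u i)⁻¹.val) y - z⁻¹ • (y - sumConj J (fun _ => 1) y) = x
  rw [h5, h6, h4, sub_sub_sub_cancel_left, ← smul_sub, inv_smul_smul₀ hz]
  abel

theorem isCompactOperator_sum {α X Y : Type*} [NormedAddCommGroup X] [NormedSpace ℂ X]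
    [NormedAddCommGroup Y] [NormedSpace ℂ Y] {s : Finset α} {A : α → X →L[ℂ] Y}
    (hA : ∀ i ∈ s, IsCompactOperator (A i)) : IsCompactOperator (∑ i ∈ s, A i : X →L[ℂ] Y) :=
  Submodule.sum_mem (compactOperator (RingHom.id ℂ) X Y) hA

theorem isCompactOperator_sumConj_mul {J : ι → E →L[ℂ] H} {J' : κ → F →L[ℂ] H}
    (hJJ : ∀ i j, IsCompactOperator ((J i).adjoint ∘L J' j)) (M : ι → E →L[ℂ] E)
    (M' : κ → F →L[ℂ] F) : IsCompactOperator (sumConj J M * sumConj J' M') := by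
  have : sumConj J M * sumConj J' M' = ∑ i, ∑ j,
      (J i ∘L M i) ∘L ((J i).adjoint ∘L J' j) ∘L (M' j ∘L (J' j).adjoint) := by
    ext x
    simp [sumConj_apply, sum_apply, map_sum]
    exact Finset.sum_comm
  rw [this]
  exact isCompactOperator_sum fun i _ => isCompactOperator_sum fun j _ =>
    ((hJJ i j).comp_clm (M' j ∘L (J' j).adjoint)).clm_comp (J i ∘L M i)

/-- With left inverses `R`, `R'` of `A - z`, `A' - z`, multiplying `z(A + A' - z) = AA' - (A - z)(A'
- z)` by `-R'R` shows that `-zR'R` is a left inverse of `A + A' - z` up to the compact operator `R'R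
AA'`. -/
theorem not_mem_essentialSpectrum_sumConj_add {J : ι → E →L[ℂ] H} (hJ : IsOrthoIsometric J)
    {J' : κ → F →L[ℂ] H} (hJ' : IsOrthoIsometric J')
    (hJJ : ∀ i j, IsCompactOperator ((J i).adjoint ∘L J' j))
    {M : ι → E →L[ℂ] E} (hM : ∀ i, IsSelfAdjoint (M i))
    {M' : κ → F →L[ℂ] F} (hM' : ∀ j, IsSelfAdjoint (M' j)) {z : ℂ} (hz : z ≠ 0)
    (hMz : ∀ i, z ∉ spectrum ℂ (M i)) (hMz' : ∀ j, z ∉ spectrum ℂ (M' j)) :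
    z ∉ essentialSpectrum (sumConj J M + sumConj J' M') := by
  obtain ⟨R, hR⟩ := hJ.exists_mul_sumConj_sub_eq_one hz
    fun i => not_not.1 (mt mem_spectrum_iff_not_isUnit_sub.2 (hMz i))
  obtain ⟨R', hR'⟩ := hJ'.exists_mul_sumConj_sub_eq_one hz
    fun i => not_not.1 (mt mem_spectrum_iff_not_isUnit_sub.2 (hMz' i))
  refine not_mem_essentialSpectrum_of_isCompactOperator
    ((isSelfAdjoint_sumConj J hM).add (isSelfAdjoint_sumConj J' hM')) (B := -(z • (R' * R)))
    (K := R' * R * (sumConj J M * sumConj J' M'))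
    ((isCompactOperator_sumConj_mul hJJ M M').clm_comp (R' * R)) ?_
  set A := sumConj J M
  set A' := sumConj J' M'
  have key : z • (A + A' - z • (1 : H →L[ℂ] H)) =
      A * A' - (A - z • (1 : H →L[ℂ] H)) * (A' - z • (1 : H →L[ℂ] H)) := by
    simp only [sub_mul, mul_sub, smul_mul_assoc, mul_smul_comm, one_mul, mul_one, smul_add,
      smul_sub]
    abel
  have h1 : R' * R * ((A - z • (1 : H →L[ℂ] H)) * (A' - z • (1 : H →L[ℂ] H))) = 1 := by
    rw [mul_assoc, ← mul_assoc R, hR, one_mul, hR']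
  change _ = 1 - R' * R * (A * A')
  rw [neg_mul, smul_mul_assoc, ← mul_smul_comm, key, mul_sub, h1, neg_sub]

theorem tendsto_sumConj_zero (J : ι → E →L[ℂ] H) (M : ι → E →L[ℂ] E) {x : ℕ → H}
    (hx : ∀ i, Tendsto (fun k => (J i).adjoint (x k)) atTop (𝓝 0)) :
    Tendsto (fun k => sumConj J M (x k)) atTop (𝓝 0) := by
  simp only [sumConj_apply]
  rw [show (0 : H) = ∑ _i : ι, 0 by simp]
  refine tendsto_finsetSum _ fun i _ => ?_
  simpa [Function.comp_def] using (((J i ∘L M i).continuous.tendsto 0).comp (hx i))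

theorem IsWeaklyNullUnit.map {v : ℕ → E} (hv : IsWeaklyNullUnit v) {V : E →L[ℂ] H}
    (hV : ∀ v, V.adjoint (V v) = v) : IsWeaklyNullUnit fun k => V (v k) where
  norm_eq_one k := by
    have h : ‖V (v k)‖ ^ 2 = 1 := by
      rw [← inner_self_eq_norm_sq (𝕜 := ℂ), ← ContinuousLinearMap.adjoint_inner_left, hV,
        inner_self_eq_norm_sq, hv.norm_eq_one, one_pow]
    exact (pow_eq_one_iff_of_nonneg (norm_nonneg _) two_ne_zero).1 h
  tendsto_inner y := by
    simpa only [ContinuousLinearMap.adjoint_inner_left] using hv.tendsto_inner (V.adjoint y)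

/-- `J_i v_k` is a Weyl sequence: the first sum acts on it as `M_i`, and the second tends to zero
because each `J'_j* J_i` has rank one and `v_k` is weakly null. -/
theorem mem_essentialSpectrum_sumConj_add {J : ι → E →L[ℂ] H} (hJ : IsOrthoIsometric J)
    {J' : κ → F →L[ℂ] H} {M : ι → E →L[ℂ] E} (hM : ∀ i, IsSelfAdjoint (M i))
    {M' : κ → F →L[ℂ] F} (hM' : ∀ j, IsSelfAdjoint (M' j)) {z : ℂ} {v : ℕ → E}
    (hv : IsWeaklyNullUnit v) (i : ι)
    (hJJ : ∀ j, ∃ x y, ∀ w, (J' j).adjoint (J i w) = inner ℂ x w • y)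
    (hz : Tendsto (fun k => M i (v k) - z • v k) atTop (𝓝 0)) :
    z ∈ essentialSpectrum (sumConj J M + sumConj J' M') := by
  refine mem_essentialSpectrum_of_isWeaklyNullUnit
    ((isSelfAdjoint_sumConj J hM).add (isSelfAdjoint_sumConj J' hM')) (hv.map (hJ i).1) ?_
  have h1 : Tendsto (fun k => J i (M i (v k) - z • v k)) atTop (𝓝 0) := by
    simpa [Function.comp_def] using ((J i).continuous.tendsto 0).comp hz
  have h2 := tendsto_sumConj_zero J' M' (x := fun k => J i (v k)) fun j => by
    obtain ⟨x, y, hxy⟩ := hJJ j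
    simpa [hxy] using (hv.tendsto_inner x).smul_const y
  have h3 := h1.add h2
  rw [zero_add] at h3
  refine h3.congr fun k => ?_
  simp only [add_apply, hJ.sumConj_comp, map_sub, map_smul]
  abel

end Compressions

/-! ### Tensor products in `L²` and the form of the partial integral operators. -/

section Tensor

open Filter Topology

variable {μ ν : Measure ℝ}

theorem ae_prod_fst {P : ℝ → Prop} (h : ∀ᵐ x ∂μ, P x) : ∀ᵐ z ∂(μ.prod ν), P z.1 :=
  Measure.quasiMeasurePreserving_fst.ae h

/-- Multiplication by an essentially bounded real function on `L²`. -/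
noncomputable def mulOp (h : Lp ℝ ∞ ν) : Lp ℂ 2 ν →L[ℂ] Lp ℂ 2 ν :=
  (ContinuousLinearMap.mul ℂ ℂ).holderL ν ∞ 2 2 ((memLp_ofReal_top h).toLp _)

theorem mulOp_ae_eq (h : Lp ℝ ∞ ν) (v : Lp ℂ 2 ν) :
    mulOp h v =ᵐ[ν] fun y => (h y : ℂ) * v y := by
  filter_upwards [(ContinuousLinearMap.mul ℂ ℂ).coeFn_holder (r := 2)
    ((memLp_ofReal_top h).toLp _) v, (memLp_ofReal_top h).coeFn_toLp] with y h1 h2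
  exact h1.trans (by rw [h2]; rfl)

theorem isSelfAdjoint_mulOp (h : Lp ℝ ∞ ν) : IsSelfAdjoint (mulOp h) := by
  rw [ContinuousLinearMap.isSelfAdjoint_iff_isSymmetric]
  intro v w
  change inner ℂ (mulOp h v) w = inner ℂ v (mulOp h w)
  rw [L2.inner_def, L2.inner_def]
  refine integral_congr_ae ?_
  filter_upwards [mulOp_ae_eq h v, mulOp_ae_eq h w] with y h1 h2
  rw [h1, h2]
  simp only [RCLike.inner_apply, map_mul, Complex.conj_ofReal]
  ring

variable [SFinite μ] [SFinite ν]

theorem memLp_tensor (u : Lp ℂ 2 μ) (v : Lp ℂ 2 ν) :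
    MemLp (fun z : ℝ × ℝ => u z.1 * v z.2) 2 (μ.prod ν) :=
  ⟨(Lp.memLp u).1.comp_fst.mul (Lp.memLp v).1.comp_snd, by
    rw [eLpNorm_two_prod_mul (Lp.memLp u).1 (Lp.memLp v).1]
    exact ENNReal.mul_lt_top (Lp.memLp u).2 (Lp.memLp v).2⟩

/-- The tensor product `(x, y) ↦ u(x) v(y)` of two `L²` functions. -/
noncomputable def tensorLp (u : Lp ℂ 2 μ) (v : Lp ℂ 2 ν) : Lp ℂ 2 (μ.prod ν) :=
  (memLp_tensor u v).toLp _

theorem coeFn_tensorLp (u : Lp ℂ 2 μ) (v : Lp ℂ 2 ν) :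
    tensorLp u v =ᵐ[μ.prod ν] fun z => u z.1 * v z.2 :=
  MemLp.coeFn_toLp _

theorem norm_tensorLp (u : Lp ℂ 2 μ) (v : Lp ℂ 2 ν) : ‖tensorLp u v‖ = ‖u‖ * ‖v‖ := by
  rw [tensorLp, Lp.norm_toLp, eLpNorm_two_prod_mul (Lp.memLp u).1 (Lp.memLp v).1,
    ENNReal.toReal_mul, Lp.norm_def, Lp.norm_def]

theorem inner_tensorLp (u u' : Lp ℂ 2 μ) (v v' : Lp ℂ 2 ν) :
    inner ℂ (tensorLp u v) (tensorLp u' v') = inner ℂ u u' * inner ℂ v v' := by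
  rw [L2.inner_def, L2.inner_def, L2.inner_def, ← integral_prod_mul]
  refine integral_congr_ae ?_
  filter_upwards [coeFn_tensorLp u v, coeFn_tensorLp u' v'] with z h1 h2
  simp only [h1, h2, RCLike.inner_apply, map_mul]
  ring

/-- Tensoring with `u` on the left, `v ↦ u ⊗ v`. -/
noncomputable def tensorLeft (u : Lp ℂ 2 μ) : Lp ℂ 2 ν →L[ℂ] Lp ℂ 2 (μ.prod ν) :=
  LinearMap.mkContinuous
    { toFun := fun v => tensorLp u v
      map_add' := fun v w => Lp.ext <| by
        filter_upwards [coeFn_tensorLp u v, coeFn_tensorLp u w, coeFn_tensorLp u (v + w),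
          Lp.coeFn_add (tensorLp u v) (tensorLp u w), ae_prod_snd (Lp.coeFn_add v w)]
          with z h1 h2 h3 h4 h5
        rw [h3, h4, Pi.add_apply, h1, h2, h5, Pi.add_apply, mul_add]
      map_smul' := fun c v => Lp.ext <| by
        filter_upwards [coeFn_tensorLp u v, coeFn_tensorLp u (c • v),
          Lp.coeFn_smul c (tensorLp u v), ae_prod_snd (Lp.coeFn_smul c v)] with z h1 h2 h3 h4
        rw [RingHom.id_apply, h2, h3, Pi.smul_apply, h1, h4, Pi.smul_apply, mul_smul_comm] }
    ‖u‖ fun v => (norm_tensorLp u v).le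

/-- Tensoring with `v` on the right, `u ↦ u ⊗ v`. -/
noncomputable def tensorRight (v : Lp ℂ 2 ν) : Lp ℂ 2 μ →L[ℂ] Lp ℂ 2 (μ.prod ν) :=
  LinearMap.mkContinuous
    { toFun := fun u => tensorLp u v
      map_add' := fun u w => Lp.ext <| by
        filter_upwards [coeFn_tensorLp u v, coeFn_tensorLp w v, coeFn_tensorLp (u + w) v,
          Lp.coeFn_add (tensorLp u v) (tensorLp w v), ae_prod_fst (Lp.coeFn_add u w)]
          with z h1 h2 h3 h4 h5
        rw [h3, h4, Pi.add_apply, h1, h2, h5, Pi.add_apply, add_mul]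
      map_smul' := fun c u => Lp.ext <| by
        filter_upwards [coeFn_tensorLp u v, coeFn_tensorLp (c • u) v,
          Lp.coeFn_smul c (tensorLp u v), ae_prod_fst (Lp.coeFn_smul c u)] with z h1 h2 h3 h4
        rw [RingHom.id_apply, h2, h3, Pi.smul_apply, h1, h4, Pi.smul_apply, smul_mul_assoc] }
    ‖v‖ fun u => (norm_tensorLp u v).le.trans_eq (mul_comm _ _)

theorem tensorLeft_apply (u : Lp ℂ 2 μ) (v : Lp ℂ 2 ν) : tensorLeft u v = tensorLp u v := rfl

theorem tensorRight_apply (u : Lp ℂ 2 μ) (v : Lp ℂ 2 ν) : tensorRight v u = tensorLp u v := rfl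

theorem adjoint_tensorLeft_tensorLp (u u' : Lp ℂ 2 μ) (v : Lp ℂ 2 ν) :
    (tensorLeft u).adjoint (tensorLp u' v) = inner ℂ u u' • v :=
  ext_inner_left ℂ fun w => by
    rw [ContinuousLinearMap.adjoint_inner_right, tensorLeft_apply, inner_tensorLp, inner_smul_right]

theorem adjoint_tensorRight_tensorLp (u : Lp ℂ 2 μ) (v v' : Lp ℂ 2 ν) :
    (tensorRight v).adjoint (tensorLp u v') = inner ℂ v v' • u :=
  ext_inner_left ℂ fun w => by
    rw [ContinuousLinearMap.adjoint_inner_right, tensorRight_apply, inner_tensorLp,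
      inner_smul_right, mul_comm]

/-- Fubini: integrating `⟨u ⊗ v, f⟩` first in the variable of `u` leaves the pairing of `v` with the
slice coefficient. -/
theorem adjoint_tensorLeft_ae_eq (u : Lp ℂ 2 μ) (f : Lp ℂ 2 (μ.prod ν)) :
    (tensorLeft u).adjoint f =ᵐ[ν] sliceCoeff u f := by
  have hm := memLp_sliceCoeff u (Lp.memLp f)
  suffices h : (tensorLeft u).adjoint f = hm.toLp _ by
    rw [h]; exact hm.coeFn_toLp
  refine ext_inner_left ℂ fun v => ?_
  rw [ContinuousLinearMap.adjoint_inner_right, tensorLeft_apply, L2.inner_def,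
    integral_prod_symm _ (L2.integrable_inner _ _), L2.inner_def]
  refine integral_congr_ae ?_
  filter_upwards [hm.coeFn_toLp, ae_ae_slice (coeFn_tensorLp u v)] with y h1 h2
  rw [h1, sliceCoeff, RCLike.inner_apply, ← integral_mul_const]
  refine integral_congr_ae ?_
  filter_upwards [h2] with s hs
  rw [hs, RCLike.inner_apply, map_mul]
  ring

theorem adjoint_tensorRight_ae_eq (v : Lp ℂ 2 ν) (f : Lp ℂ 2 (μ.prod ν)) :
    (tensorRight v).adjoint f =ᵐ[μ] sliceCoeff v (f ∘ Prod.swap) := by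
  have hm := memLp_sliceCoeff v (memLp_swap (Lp.memLp f))
  suffices h : (tensorRight v).adjoint f = hm.toLp _ by
    rw [h]; exact hm.coeFn_toLp
  refine ext_inner_left ℂ fun u => ?_
  rw [ContinuousLinearMap.adjoint_inner_right, tensorRight_apply, L2.inner_def,
    integral_prod _ (L2.integrable_inner _ _), L2.inner_def]
  refine integral_congr_ae ?_
  filter_upwards [hm.coeFn_toLp, Measure.ae_ae_of_ae_prod (coeFn_tensorLp u v)] with x h1 h2
  rw [h1, sliceCoeff, RCLike.inner_apply, ← integral_mul_const]
  refine integral_congr_ae ?_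
  filter_upwards [h2] with t ht
  rw [ht, RCLike.inner_apply, map_mul]
  simp only [Function.comp, Prod.swap]
  ring

theorem isOrthoIsometric_tensorLeft {ι : Type*} {φ : ι → Lp ℂ 2 μ} (hφ : Orthonormal ℂ φ) :
    IsOrthoIsometric fun i => tensorLeft (ν := ν) (φ i) := by
  refine fun i => ⟨fun v => ?_, fun k hik v => ?_⟩
  · rw [tensorLeft_apply, adjoint_tensorLeft_tensorLp, inner_self_eq_norm_sq_to_K, hφ.1 i]
    simp
  · rw [tensorLeft_apply, adjoint_tensorLeft_tensorLp, hφ.2 hik, zero_smul]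

theorem isOrthoIsometric_tensorRight {ι : Type*} {ψ : ι → Lp ℂ 2 ν} (hψ : Orthonormal ℂ ψ) :
    IsOrthoIsometric fun j => tensorRight (μ := μ) (ψ j) := by
  refine fun i => ⟨fun v => ?_, fun k hik v => ?_⟩
  · rw [tensorRight_apply, adjoint_tensorRight_tensorLp, inner_self_eq_norm_sq_to_K, hψ.1 i]
    simp
  · rw [tensorRight_apply, adjoint_tensorRight_tensorLp, hψ.2 hik, zero_smul]

/-- The composite sends `w` to `⟨u, w⟩ v`, so it factors through `ℂ`. -/
theorem isCompactOperator_adjoint_tensorLeft_comp_tensorRight (u : Lp ℂ 2 μ) (v : Lp ℂ 2 ν) :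
    IsCompactOperator ((tensorLeft u).adjoint ∘L tensorRight v) := by
  have : ((tensorLeft u).adjoint ∘L tensorRight v : Lp ℂ 2 μ → Lp ℂ 2 ν) =
      ContinuousLinearMap.toSpanSingleton ℂ v ∘ innerSL ℂ u := by
    funext w
    rw [ContinuousLinearMap.comp_apply, tensorRight_apply, adjoint_tensorLeft_tensorLp]
    simp
  rw [this]
  have h1 : IsCompactOperator (innerSL ℂ u) := isCompactOperator_of_locallyCompactSpace_dom _
  exact h1.clm_comp (ContinuousLinearMap.toSpanSingleton ℂ v)

theorem partialIntegralOp₁_eq_sumConj {n : ℕ} (φ : Fin n → Lp ℂ 2 μ) (h : Fin n → Lp ℝ ∞ ν) :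
    partialIntegralOp₁ φ h = sumConj (fun i => tensorLeft (φ i)) fun i => mulOp (h i) := by
  ext1 f
  refine Lp.ext ?_
  have h0 : ∀ i, tensorLeft (φ i) (mulOp (h i) ((tensorLeft (φ i)).adjoint f)) =ᵐ[μ.prod ν]
      degenerateTerm (φ i) (h i) f := fun i => by
    filter_upwards [coeFn_tensorLp (φ i) (mulOp (h i) ((tensorLeft (φ i)).adjoint f)),
      ae_prod_snd (mulOp_ae_eq (h i) ((tensorLeft (φ i)).adjoint f)),
      ae_prod_snd (adjoint_tensorLeft_ae_eq (φ i) f)] with z h1 h2 h3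
    rw [tensorLeft_apply, h1, h2, h3, degenerateTerm]
  rw [sumConj_apply]
  filter_upwards [partialIntegralOp₁_ae_eq φ h f, partialInt₁_ae_eq_sum φ h (Lp.memLp f),
    Lp.coeFn_fun_finsetSum Finset.univ fun i =>
      tensorLeft (φ i) (mulOp (h i) ((tensorLeft (φ i)).adjoint f)),
    ae_all_iff.2 h0] with z h1 h2 h3 h4
  rw [h1, h2, h3]
  exact Finset.sum_congr rfl fun i _ => (h4 i).symm

theorem partialIntegralOp₂_eq_sumConj {m : ℕ} (p : Fin m → Lp ℝ ∞ μ) (ψ : Fin m → Lp ℂ 2 ν) :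
    partialIntegralOp₂ p ψ = sumConj (fun j => tensorRight (ψ j)) fun j => mulOp (p j) := by
  ext1 f
  refine Lp.ext ?_
  have h0 : ∀ j, tensorRight (ψ j) (mulOp (p j) ((tensorRight (ψ j)).adjoint f)) =ᵐ[μ.prod ν]
      degenerateTerm (ψ j) (p j) (f ∘ Prod.swap) ∘ Prod.swap := fun j => by
    filter_upwards [coeFn_tensorLp (mulOp (p j) ((tensorRight (ψ j)).adjoint f)) (ψ j),
      ae_prod_fst (mulOp_ae_eq (p j) ((tensorRight (ψ j)).adjoint f)),
      ae_prod_fst (adjoint_tensorRight_ae_eq (ψ j) f)] with z h1 h2 h3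
    rw [tensorRight_apply, h1, h2, h3, Function.comp_apply, degenerateTerm, mul_comm]
    rfl
  have hs := (Measure.measurePreserving_swap (μ := μ) (ν := ν)).quasiMeasurePreserving.ae
    (partialInt₁_ae_eq_sum ψ p (memLp_swap (Lp.memLp f)))
  rw [sumConj_apply]
  filter_upwards [partialIntegralOp₂_ae_eq p ψ f, hs,
    Lp.coeFn_fun_finsetSum Finset.univ fun j =>
      tensorRight (ψ j) (mulOp (p j) ((tensorRight (ψ j)).adjoint f)),
    ae_all_iff.2 h0] with z h1 h2 h3 h4
  rw [h1, partialInt₂_eq_swap, Function.comp_apply, h2, h3]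
  exact Finset.sum_congr rfl fun i _ => (h4 i).symm

end Tensor

/-! ### Multiplication operators, essential ranges and Weyl sequences. -/

section EssentialRange

open Filter Topology

variable {μ ν : Measure ℝ}

/-- The spectrum is real, and if a real `r` is not an essential value, then `|h - r| ≥ ε` almost
everywhere for some `ε > 0`, so multiplication by `h - r` is bounded below. -/
theorem spectrum_mulOp_subset (h : Lp ℝ ∞ ν) :
    spectrum ℂ (mulOp h) ⊆ Complex.ofReal '' essRan ν h := by
  intro z hz
  have hr : z = (z.re : ℂ) := (isSelfAdjoint_mulOp h).mem_spectrum_eq_re hz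
  refine ⟨z.re, ?_, hr.symm⟩
  by_contra hn
  simp only [essRan, Set.mem_ofPred_eq, not_forall, not_lt, nonpos_iff_eq_zero] at hn
  obtain ⟨ε, hε, h0⟩ := hn
  rw [hr] at hz
  refine mem_spectrum_iff_not_isUnit_sub.1 hz
    (((isSelfAdjoint_mulOp h).sub_real_smul_one z.re).isUnit_of_le_norm hε fun v => ?_)
  have h1 : ‖(ε : ℂ) • v‖ = ε * ‖v‖ := by
    rw [norm_smul, Complex.norm_real, Real.norm_of_nonneg hε.le]
  rw [← h1]
  refine Lp.norm_le_norm_of_ae_le ?_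
  have h2 : ∀ᵐ y ∂ν, ¬(z.re - ε < h y ∧ h y < z.re + ε) := measure_eq_zero_iff_ae_notMem.1 h0
  filter_upwards [h2, mulOp_ae_eq h v, Lp.coeFn_smul (ε : ℂ) v, Lp.coeFn_smul (z.re : ℂ) v,
    Lp.coeFn_sub (mulOp h v) ((z.re : ℂ) • v)] with y h2 h3 h4 h5 h6
  have h7 : (mulOp h - (z.re : ℂ) • (1 : Lp ℂ 2 ν →L[ℂ] Lp ℂ 2 ν)) v =
    mulOp h v - (z.re : ℂ) • v := rfl
  rw [h7, h4, h6, Pi.sub_apply, h3, h5, Pi.smul_apply, Pi.smul_apply, smul_eq_mul, smul_eq_mul,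
    ← sub_mul, norm_mul, norm_mul, ← Complex.ofReal_sub, Complex.norm_real, Complex.norm_real,
    Real.norm_of_nonneg hε.le, Real.norm_eq_abs]
  gcongr
  by_contra! hlt
  rw [abs_lt] at hlt
  exact h2 ⟨by linarith, by linarith⟩

/-- Some point of `s` has only neighbourhoods of positive measure within `s`; intersect `s` with a
ball of Lebesgue measure `δ` about it. Domination by Lebesgue measure is what rules out atoms. -/
theorem exists_small_subset_of_le_volume (hν : ν ≤ volume) {s : Set ℝ} (hs : MeasurableSet s)
    (h0 : ν s ≠ 0) {δ : ℝ} (hδ : 0 < δ) :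
    ∃ t ⊆ s, MeasurableSet t ∧ ν t ≠ 0 ∧ ν t ≤ ENNReal.ofReal δ := by
  obtain ⟨x, -, hx⟩ := exists_mem_forall_mem_nhdsWithin_pos_measure h0
  refine ⟨s ∩ Metric.ball x (δ / 2), Set.inter_subset_left, hs.inter measurableSet_ball,
    (hx _ ?_).ne', ?_⟩
  · exact inter_mem_nhdsWithin _ (Metric.ball_mem_nhds x (half_pos hδ))
  · refine (measure_mono Set.inter_subset_right).trans ((hν _).trans ?_)
    rw [Real.volume_ball, mul_div_cancel₀ _ two_ne_zero]

/-- Take normalized indicators of sets `B_k` of measure at most `1/(k+1)` on which `|h - r| <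
1/(k+1)`. The second bound makes them approximate eigenvectors; the first makes them weakly null, by
absolute continuity of the integral of `|g|²`. -/
theorem exists_weaklyNull_unit_of_mem_essRan (hν : ν ≤ volume) {h : Lp ℝ ∞ ν} {r : ℝ}
    (hr : r ∈ essRan ν h) : ∃ v : ℕ → Lp ℂ 2 ν, IsWeaklyNullUnit v ∧
      Tendsto (fun k => mulOp h (v k) - (r : ℂ) • v k) atTop (𝓝 0) := by
  have hδ : ∀ k : ℕ, 0 < 1 / ((k : ℝ) + 1) := fun k => by positivity
  have hmeas : Measurable h := (Lp.stronglyMeasurable h).measurable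
  choose B hBs hBm hB0 hBle using fun k : ℕ => exists_small_subset_of_le_volume hν
    ((hmeas measurableSet_Ioo : MeasurableSet
      (h ⁻¹' Set.Ioo (r - 1 / ((k : ℝ) + 1)) (r + 1 / ((k : ℝ) + 1)))))
    (hr _ (hδ k)).ne' (hδ k)
  have hBt : ∀ k, ν (B k) ≠ ∞ := fun k => ((hBle k).trans_lt ENNReal.ofReal_lt_top).ne
  have hpos : ∀ k, 0 < ν.real (B k) := fun k => ENNReal.toReal_pos (hB0 k) (hBt k)
  set v : ℕ → Lp ℂ 2 ν := fun k =>
    indicatorConstLp 2 (hBm k) (hBt k) (((ν.real (B k) ^ (1 / 2 : ℝ))⁻¹ : ℝ) : ℂ) with hvdef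
  have hv1 : ∀ k, ‖v k‖ = 1 := fun k => by
    have hp : 0 < ν.real (B k) ^ (1 / 2 : ℝ) := Real.rpow_pos_of_pos (hpos k) _
    rw [hvdef]
    simp only
    rw [norm_indicatorConstLp two_ne_zero ENNReal.ofNat_ne_top, Complex.norm_real,
      Real.norm_of_nonneg (by positivity), ENNReal.toReal_ofNat, inv_mul_cancel₀ hp.ne']
  have hv0 : ∀ k, ∀ᵐ y ∂ν, y ∉ B k → v k y = 0 := fun k => indicatorConstLp_coeFn_notMem
  refine ⟨v, ⟨hv1, fun g => ?_⟩, ?_⟩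
  · rw [Metric.tendsto_atTop]
    intro ε hε
    obtain ⟨δ, hδ0, hδ⟩ := (Lp.memLp g).eLpNorm_indicator_le one_le_two ENNReal.ofNat_ne_top
      (half_pos hε)
    obtain ⟨N, hN⟩ := exists_nat_one_div_lt hδ0
    refine ⟨N, fun k hk => ?_⟩
    have hle : eLpNorm ((B k).indicator g) 2 ν ≤ ENNReal.ofReal (ε / 2) := by
      refine hδ _ (hBm k) ((hBle k).trans (ENNReal.ofReal_le_ofReal (le_trans ?_ hN.le)))
      exact one_div_le_one_div_of_le (by positivity) (by gcongr)
    have hmem : MemLp ((B k).indicator g) 2 ν := (Lp.memLp g).indicator (hBm k)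
    -- Since `v k` vanishes off `B k`, only the restriction of `g` to `B k` matters, and its norm is
    -- small.
    have heq : inner ℂ g (v k) = inner ℂ (hmem.toLp _) (v k) := by
      rw [L2.inner_def, L2.inner_def]
      refine integral_congr_ae ?_
      filter_upwards [hv0 k, hmem.coeFn_toLp] with y h1 h2
      rw [h2]
      by_cases hy : y ∈ B k
      · rw [Set.indicator_of_mem hy]
      · rw [h1 hy, inner_zero_right, inner_zero_right]
    rw [dist_zero_right, heq]
    calc ‖inner ℂ (hmem.toLp _) (v k)‖ ≤ ‖hmem.toLp _‖ * ‖v k‖ := norm_inner_le_norm _ _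
      _ ≤ ε / 2 := by
        rw [hv1, mul_one, Lp.norm_toLp]
        exact ENNReal.toReal_le_of_le_ofReal (by positivity) hle
      _ < ε := half_lt_self hε
  · refine squeeze_zero_norm (fun k => ?_) tendsto_one_div_add_atTop_nhds_zero_nat
    refine (Lp.norm_le_mul_norm_of_ae_le_mul (c := 1 / ((k : ℝ) + 1)) (g := v k) ?_).trans_eq
      (by rw [hv1, mul_one])
    filter_upwards [hv0 k, mulOp_ae_eq h (v k), Lp.coeFn_smul (r : ℂ) (v k),
      Lp.coeFn_sub (mulOp h (v k)) ((r : ℂ) • v k)] with y h1 h2 h3 h4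
    rw [h4, Pi.sub_apply, h2, h3, Pi.smul_apply, smul_eq_mul, ← sub_mul, norm_mul,
      ← Complex.ofReal_sub, Complex.norm_real, Real.norm_eq_abs]
    by_cases hy : y ∈ B k
    · have := hBs k hy
      gcongr
      exact (abs_lt.2 ⟨by linarith [this.1], by linarith [this.2]⟩).le
    · simp [h1 hy]

/-- Apply the previous construction to the zero function, whose level sets at `0` have full measure.
-/
theorem exists_weaklyNull_unit (hν : ν ≤ volume) (h0 : ν ≠ 0) :
    ∃ v : ℕ → Lp ℂ 2 ν, IsWeaklyNullUnit v := by
  have : (0 : ℝ) ∈ essRan ν (0 : Lp ℝ ∞ ν) := fun ε hε => by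
    rw [measure_congr (t := Set.univ), Measure.measure_univ_pos]
    · exact h0
    · filter_upwards [Lp.coeFn_zero ℝ ∞ ν] with y hy
      refine propext ⟨fun _ => trivial, fun _ => ?_⟩
      change 0 - ε < _ ∧ _ < 0 + ε
      rw [hy]
      simpa using hε
  obtain ⟨v, hv, -⟩ := exists_weaklyNull_unit_of_mem_essRan hν this
  exact ⟨v, hv⟩

/-- A weakly null unit sequence forces infinite dimension: were the finite-dimensional span
everything, the sequence would tend to zero in norm. -/
theorem IsWeaklyNullUnit.exists_unit_orthogonal {H ι : Type*} [NormedAddCommGroup H]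
    [InnerProductSpace ℂ H] [CompleteSpace H] [Finite ι] {v : ℕ → H} (hv : IsWeaklyNullUnit v)
    (φ : ι → H) : ∃ u : H, ‖u‖ = 1 ∧ ∀ i, inner ℂ (φ i) u = 0 := by
  have hfin : FiniteDimensional ℂ (Submodule.span ℂ (Set.range φ)) :=
    FiniteDimensional.span_of_finite ℂ (Set.finite_range φ)
  have hne : (Submodule.span ℂ (Set.range φ))ᗮ ≠ ⊥ := fun hbot => by
    rw [Submodule.orthogonal_eq_bot_iff] at hbot
    have h0 := tendsto_zero_of_finiteDimensional hv (Q := 1)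
      (N := Submodule.span ℂ (Set.range φ)) fun y => by rw [hbot]; trivial
    have := tendsto_nhds_unique h0.norm (by simp [hv.norm_eq_one] :
      Tendsto (fun k => ‖(1 : H →L[ℂ] H) (v k)‖) atTop (𝓝 1))
    simp at this
  obtain ⟨w, hw, hw0⟩ := Submodule.exists_mem_ne_zero_of_ne_bot hne
  refine ⟨((‖w‖⁻¹ : ℝ) : ℂ) • w, ?_, fun i => ?_⟩
  · simp [norm_smul, hw0]
  · rw [inner_smul_right, (Submodule.mem_orthogonal _ _).1 hw _ (Submodule.subset_span ⟨i, rfl⟩),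
      mul_zero]

theorem intervalMeasure_ne_zero {a b : ℝ} (hab : a < b) : intervalMeasure a b ≠ 0 := by
  rw [Ne, Measure.restrict_eq_zero, Real.volume_Icc]
  simpa using hab

variable [SFinite μ] [SFinite ν]

/-- Use `u ⊗ v_k` with `u` a unit vector orthogonal to every `φ_i` and `v_k` weakly null. The first
operator annihilates it, and the second sees it only through `⟨ψ_j, v_k⟩ u`, which tends to zero. -/
theorem zero_mem_essentialSpectrum (hμ : μ ≤ volume) (hμ0 : μ ≠ 0) (hν : ν ≤ volume) (hν0 : ν ≠ 0)
    {n m : ℕ} (φ : Fin n → Lp ℂ 2 μ) (h : Fin n → Lp ℝ ∞ ν) (ψ : Fin m → Lp ℂ 2 ν)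
    (p : Fin m → Lp ℝ ∞ μ) :
    0 ∈ essentialSpectrum (partialIntegralOp₁ φ h + partialIntegralOp₂ p ψ) := by
  obtain ⟨w, hw⟩ := exists_weaklyNull_unit hμ hμ0
  obtain ⟨v, hv⟩ := exists_weaklyNull_unit hν hν0
  obtain ⟨u, hu, hφu⟩ := hw.exists_unit_orthogonal φ
  rw [partialIntegralOp₁_eq_sumConj, partialIntegralOp₂_eq_sumConj]
  refine mem_essentialSpectrum_of_isWeaklyNullUnit
    ((isSelfAdjoint_sumConj _ fun i => isSelfAdjoint_mulOp _).add
      (isSelfAdjoint_sumConj _ fun i => isSelfAdjoint_mulOp _))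
    (hv.map (V := tensorLeft u) fun x => ?_) ?_
  · rw [tensorLeft_apply, adjoint_tensorLeft_tensorLp, inner_self_eq_norm_sq_to_K, hu]
    simp
  · have h1 := tendsto_sumConj_zero (fun i => tensorLeft (φ i)) (fun i => mulOp (h i))
      (x := fun k => tensorLeft u (v k)) fun i => by
        simp only [tensorLeft_apply, adjoint_tensorLeft_tensorLp, hφu, zero_smul,
          tendsto_const_nhds]
    have h2 := tendsto_sumConj_zero (fun j => tensorRight (ψ j)) (fun j => mulOp (p j))
      (x := fun k => tensorLeft u (v k)) fun j => by
        simp only [tensorLeft_apply, adjoint_tensorRight_tensorLp]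
        simpa using (hv.tendsto_inner (ψ j)).smul_const u
    simpa using h1.add h2

end EssentialRange

/-! ### The essential spectrum of the sum. -/

theorem theorem5p6 (a b c d : ℝ) (hab : a < b) (hcd : c < d) (n m : ℕ)
    (φ : Fin n → Lp ℂ 2 (intervalMeasure a b)) (hφ : Orthonormal ℂ φ)
    (h : Fin n → Lp ℝ ∞ (intervalMeasure c d))
    (ψ : Fin m → Lp ℂ 2 (intervalMeasure c d)) (hψ : Orthonormal ℂ ψ)
    (p : Fin m → Lp ℝ ∞ (intervalMeasure a b)) :
    essentialSpectrum (partialIntegralOp₁ φ h + partialIntegralOp₂ p ψ) =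
      {0} ∪ (⋃ i, Complex.ofReal '' essRan (intervalMeasure c d) (h i)) ∪
        (⋃ j, Complex.ofReal '' essRan (intervalMeasure a b) (p j)) := by
  have hJ := isOrthoIsometric_tensorLeft (ν := intervalMeasure c d) hφ
  have hJ' := isOrthoIsometric_tensorRight (μ := intervalMeasure a b) hψ
  refine Set.Subset.antisymm (fun z hz => ?_) ?_
  · by_contra hn
    simp only [Set.mem_union, Set.mem_singleton_iff, Set.mem_iUnion, not_or, not_exists] at hn
    obtain ⟨⟨hz0, hzh⟩, hzp⟩ := hn
    rw [partialIntegralOp₁_eq_sumConj, partialIntegralOp₂_eq_sumConj] at hz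
    exact not_mem_essentialSpectrum_sumConj_add hJ hJ'
      (fun i j => isCompactOperator_adjoint_tensorLeft_comp_tensorRight _ _)
      (fun i => isSelfAdjoint_mulOp _) (fun j => isSelfAdjoint_mulOp _) hz0
      (fun i hi => hzh i (spectrum_mulOp_subset _ hi))
      (fun j hj => hzp j (spectrum_mulOp_subset _ hj)) hz
  · refine Set.union_subset (Set.union_subset ?_ (Set.iUnion_subset fun i => ?_))
      (Set.iUnion_subset fun j => ?_)
    · rw [Set.singleton_subset_iff]
      exact zero_mem_essentialSpectrum Measure.restrict_le_self (intervalMeasure_ne_zero hab)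
        Measure.restrict_le_self (intervalMeasure_ne_zero hcd) φ h ψ p
    · rintro _ ⟨r, hr, rfl⟩
      obtain ⟨v, hv, hvr⟩ := exists_weaklyNull_unit_of_mem_essRan Measure.restrict_le_self hr
      rw [partialIntegralOp₁_eq_sumConj, partialIntegralOp₂_eq_sumConj]
      exact mem_essentialSpectrum_sumConj_add hJ (fun i => isSelfAdjoint_mulOp _)
        (fun j => isSelfAdjoint_mulOp _) hv i
        (fun j => ⟨ψ j, φ i, fun w => adjoint_tensorRight_tensorLp _ _ _⟩) hvr
    · rintro _ ⟨r, hr, rfl⟩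
      obtain ⟨v, hv, hvr⟩ := exists_weaklyNull_unit_of_mem_essRan Measure.restrict_le_self hr
      -- Exchanging the summands makes the family of the `ψ_j` the one that carries the Weyl
      -- sequence.
      rw [partialIntegralOp₁_eq_sumConj, partialIntegralOp₂_eq_sumConj, add_comm]
      exact mem_essentialSpectrum_sumConj_add hJ' (fun j => isSelfAdjoint_mulOp _)
        (fun i => isSelfAdjoint_mulOp _) hv j
        (fun i => ⟨φ i, ψ j, fun w => adjoint_tensorLeft_tensorLp _ _ _⟩) hvr
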